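/- All spaces are Hausdorff. A gyrogroup is a set $G$ with a binary operation $\oplus$ having a unique identity $0$ and for each $x$ a unique inverse $\ominus x$ (with $\ominus x\oplus x=0=x\oplus(\ominus x)$), such that for all $x,y\in G$ there is an automorphism $\mathrm{gyr}[x,y]$ of $(G,\oplus)$ with $x\oplus(y\oplus z)=(x\oplus y)\oplus \mathrm{gyr}[x,y](z)$ for all $z\in G$, and $\mathrm{gyr}[x\oplus y,y]=\mathrm{gyr}[x,y]$. It is a topological gyrogroup if it carries a topology for which $\oplus$ is jointly continuous and $\ominus$ is continuous. A nonempty set $H\subseteq G$ is a subgyrogroup if $H$ is a gyrogroup under the inherited operation and $\mathrm{gyr}[a,b]$ restricts to an automorphism of $H$ for all $a,b\in H$; it is an L-subgyrogroup if moreover $\mathrm{gyr}[a,h](H)=H$ for all $a\in G$, $h\in H$. The coset space $G/H=\{a\oplus H: a\in G\}$ carries the quotient topology of $\pi(a)=a\oplus H$. A space $X$ is strictly (respectively strongly) Fréchet–Urysohn if for every $x\in X$ and every sequence (respectively every decreasing sequence) $(A_n)$ of subsets of $X$ with $x\in\bigcap_n\overline{A_n}$ there are $x_n\in A_n$ with $x_n\to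 x$. Subsets carry the subspace topology. **Theorem 4.11.** Let $G$ be a topological gyrogroup and $H$ a closed L-subgyrogroup of $G$. Let "$\kappa$-compact" stand, throughout, for one of "compact", "countably compact", "sequentially compact", and suppose that every $\kappa$-compact subset of $H$ is first-countable. (a) If every $\kappa$-compact subset of $G/H$ is strongly Fréchet–Urysohn, then every $\kappa$-compact subset of $G$ is strongly Fréchet–Urysohn. (b) If every $\kappa$-compact subset of $G/H$ is strictly Fréchet–Urysohn, then every $\kappa$-compact subset of $G$ is strictly Fréchet–Urysohn. -/

import Mathlib

open Set Filter Topology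

/-- A gyrogroup, written additively: `x + y` is `x ⊕ y`, `0` is the identity, `-x` is `⊖ x`, and
`gyr x y` is the gyration `gyr[x, y]`, an automorphism of the groupoid `(G, +)`.
The identity and the inverses are automatically unique (see below). -/
class Gyrogroup (G : Type*) extends Zero G, Add G, Neg G where
  zero_op : ∀ a : G, 0 + a = a
  op_zero : ∀ a : G, a + 0 = a
  neg_op : ∀ a : G, -a + a = 0
  op_neg : ∀ a : G, a + -a = 0
  gyr : G → G → (G ≃+ G)
  gyr_assoc : ∀ x y z : G, x + (y + z) = (x + y) + gyr x y z
  gyr_loop : ∀ x y : G, gyr (x + y) y = gyr x y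

namespace Gyrogroup

theorem existsUnique_zero (G : Type*) [Gyrogroup G] :
    ∃! e : G, ∀ a : G, e + a = a ∧ a + e = a :=
  ⟨0, fun a => ⟨zero_op a, op_zero a⟩, fun e he => by
    rw [← op_zero e]; exact (he 0).1⟩

theorem neg_op_cancel_left {G : Type*} [Gyrogroup G] (x y : G) : -x + (x + y) = y := by
  have h1 : ∀ z : G, -x + (x + z) = gyr 0 x z := fun z => by
    rw [gyr_assoc, neg_op, zero_op, ← gyr_loop, neg_op]
  have h2 : x + y = x + gyr 0 x y := by
    have := gyr_assoc 0 x y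
    rwa [zero_op, zero_op] at this
  have h3 : gyr 0 x y = gyr 0 x (gyr 0 x y) := by
    rw [← h1 (gyr 0 x y), ← h2, h1]
  rw [h1]
  exact ((gyr 0 x).injective h3).symm

theorem existsUnique_neg {G : Type*} [Gyrogroup G] (x : G) :
    ∃! y : G, y + x = 0 ∧ x + y = 0 :=
  ⟨-x, ⟨neg_op x, op_neg x⟩, fun y hy => by
    rw [← neg_op_cancel_left x y, hy.2, op_zero]⟩

end Gyrogroup

/-- A topological gyrogroup: the operation is jointly continuous and `x ↦ -x` is continuous. -/
class TopologicalGyrogroup (G : Type*) [TopologicalSpace G] [Gyrogroup G] : Prop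
    extends ContinuousAdd G, ContinuousNeg G

/-- A nonempty subset closed under the operation and the inversion on which `gyr[a, b]` restricts
to an automorphism for all `a, b ∈ H`. -/
structure IsSubgyrogroup {G : Type*} [Gyrogroup G] (H : Set G) : Prop where
  nonempty : H.Nonempty
  add_mem : ∀ a ∈ H, ∀ b ∈ H, a + b ∈ H
  neg_mem : ∀ a ∈ H, -a ∈ H
  image_gyr : ∀ a ∈ H, ∀ b ∈ H, Gyrogroup.gyr a b '' H = H

/-- An L-subgyrogroup: moreover `gyr[a, h](H) = H` for all `a ∈ G` and `h ∈ H`. -/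
structure IsLSubgyrogroup {G : Type*} [Gyrogroup G] (H : Set G) : Prop
    extends IsSubgyrogroup H where
  image_gyr_left : ∀ a : G, ∀ h ∈ H, Gyrogroup.gyr a h '' H = H

/-- The left coset `a ⊕ H`. -/
def gyroLeftCoset {G : Type*} [Gyrogroup G] (H : Set G) (a : G) : Set G :=
  (fun h => a + h) '' H

/-- The coset space `G/H = {a ⊕ H : a ∈ G}`. -/
def GyroCosetSpace {G : Type*} [Gyrogroup G] (H : Set G) : Type _ :=
  {S : Set G // ∃ a : G, gyroLeftCoset H a = S}

/-- The projection `π : G → G/H`, `a ↦ a ⊕ H`. -/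
def gyroCosetProj {G : Type*} [Gyrogroup G] (H : Set G) (a : G) : GyroCosetSpace H :=
  ⟨gyroLeftCoset H a, a, rfl⟩

/-- The quotient topology: `O ⊆ G/H` is open iff `π⁻¹(O)` is open in `G`. -/
instance GyroCosetSpace.instTopologicalSpace {G : Type*} [TopologicalSpace G] [Gyrogroup G]
    (H : Set G) : TopologicalSpace (GyroCosetSpace H) :=
  TopologicalSpace.coinduced (gyroCosetProj H) inferInstance

/-- Strictly Fréchet–Urysohn spaces. -/
def StrictlyFrechetUrysohn (X : Type*) [TopologicalSpace X] : Prop :=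
  ∀ (x : X) (A : ℕ → Set X), (∀ n, x ∈ closure (A n)) →
    ∃ u : ℕ → X, (∀ n, u n ∈ A n) ∧ Tendsto u atTop (𝓝 x)

/-- Strongly Fréchet–Urysohn spaces: the same for decreasing sequences of sets. -/
def StronglyFrechetUrysohn (X : Type*) [TopologicalSpace X] : Prop :=
  ∀ (x : X) (A : ℕ → Set X), Antitone A → (∀ n, x ∈ closure (A n)) →
    ∃ u : ℕ → X, (∀ n, u n ∈ A n) ∧ Tendsto u atTop (𝓝 x)

namespace Gyrogroup

variable {G : Type*} [Gyrogroup G]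

/-! Let `π : G → G/H` be the projection, `K ⊆ G` be κ-compact and `b ∈ K` lie in the closure of
every `A n`. The trace of `K` on the fibre `b + H` is a translate of a κ-compact subset of `H`,
hence first-countable, so there are decreasing neighbourhoods `U n` of `b` whose closures meet that
trace only in `b` (`exists_antitone_nhds_inter_fibre_subset`). The hypothesis on `π '' K`, applied
to the images of `A n ∩ U n`, gives a sequence converging to `π b`; lift it to `u n ∈ A n ∩ U n`. As
`G/H` is Hausdorff, a cluster point of `u` in `K` lies in the fibre of `b` and in every `closure (U
n)`, so it is `b`; countable compactness of `K` then forces `u → b`. -/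

theorem neg_neg_eq (x : G) : - -x = x := by
  have h := neg_op_cancel_left (-x) x
  rwa [neg_op, op_zero] at h

theorem op_neg_cancel_left (x y : G) : x + (-x + y) = y := by
  have h := neg_op_cancel_left (-x) y
  rwa [neg_neg_eq] at h

end Gyrogroup

open Gyrogroup

section Cosets

variable {G : Type*} [Gyrogroup G] {H : Set G}

theorem mem_gyroLeftCoset_iff {a x : G} : x ∈ gyroLeftCoset H a ↔ -a + x ∈ H := by
  constructor
  · rintro ⟨h, hh, rfl⟩
    simpa only [neg_op_cancel_left] using hh
  · intro h
    exact ⟨_, h, op_neg_cancel_left a x⟩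

theorem IsSubgyrogroup.zero_mem (hS : IsSubgyrogroup H) : (0 : G) ∈ H := by
  obtain ⟨a, ha⟩ := hS.nonempty
  simpa only [neg_op] using hS.add_mem _ (hS.neg_mem a ha) a ha

/-- Reassociating `a + (h + l)` costs a factor `gyr a h`, which the L-condition absorbs into `H`. -/
theorem IsLSubgyrogroup.gyroLeftCoset_add (hL : IsLSubgyrogroup H) (a : G) {h : G} (hh : h ∈ H) :
    gyroLeftCoset H (a + h) = gyroLeftCoset H a := by
  ext x
  constructor
  · rintro ⟨k, hk, rfl⟩
    obtain ⟨l, hl, rfl⟩ : k ∈ gyr a h '' H := by rwa [hL.image_gyr_left a h hh]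
    exact ⟨h + l, hL.add_mem _ hh _ hl, gyr_assoc a h l⟩
  · rintro ⟨k, hk, rfl⟩
    refine ⟨gyr a h (-h + k), ?_, ?_⟩
    · rw [← hL.image_gyr_left a h hh]
      exact mem_image_of_mem _ (hL.add_mem _ (hL.neg_mem h hh) _ hk)
    · change a + h + gyr a h (-h + k) = a + k
      rw [← gyr_assoc, op_neg_cancel_left]

theorem IsLSubgyrogroup.gyroCosetProj_eq_iff (hL : IsLSubgyrogroup H) {a b : G} :
    gyroCosetProj H a = gyroCosetProj H b ↔ -a + b ∈ H := by
  rw [← mem_gyroLeftCoset_iff]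
  constructor
  · intro h
    have h' : gyroLeftCoset H a = gyroLeftCoset H b := congrArg Subtype.val h
    rw [h']
    exact ⟨0, hL.zero_mem, op_zero b⟩
  · rintro ⟨h, hh, rfl⟩
    exact Subtype.ext (hL.gyroLeftCoset_add a hh).symm

theorem continuous_gyroCosetProj [TopologicalSpace G] : Continuous (gyroCosetProj H) :=
  continuous_coinduced_rng

end Cosets

section Topology

variable {G : Type*} [TopologicalSpace G] [Gyrogroup G] [TopologicalGyrogroup G] {H : Set G}

/-- Left translation by `a` in a topological gyrogroup. -/
def gyroLeftTranslation (a : G) : G ≃ₜ G where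
  toFun x := a + x
  invFun x := -a + x
  left_inv := neg_op_cancel_left a
  right_inv := op_neg_cancel_left a
  continuous_toFun := continuous_const.add continuous_id
  continuous_invFun := continuous_const.add continuous_id

/-- Regularity: if `x` is in the closure of `W`, then `x = w + (-w + x)` with `w ∈ W` and `-w + x`
as close to `0` as desired. -/
theorem TopologicalGyrogroup.exists_mem_nhds_closure_subset {b : G} {V : Set G} (hV : V ∈ 𝓝 b) :
    ∃ W ∈ 𝓝 b, closure W ⊆ V := by
  have hadd : Tendsto (fun p : G × G => p.1 + p.2) (𝓝 b ×ˢ 𝓝 0) (𝓝 b) := by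
    have h := (continuous_add (M := G)).tendsto (b, 0)
    rwa [nhds_prod_eq, op_zero] at h
  obtain ⟨W, hW, N, hN, hWN⟩ := mem_prod_iff.1 (hadd hV)
  refine ⟨W, hW, fun x hx => ?_⟩
  have hc : Tendsto (fun w : G => -w + x) (𝓝 x) (𝓝 0) := by
    have h : Continuous fun w : G => -w + x := continuous_neg.add continuous_const
    simpa only [neg_op] using h.tendsto x
  obtain ⟨w, hwN, hwW⟩ := mem_closure_iff_nhds.1 hx _ (hc hN)
  have h : w + (-w + x) ∈ V := hWN (mk_mem_prod hwW hwN)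
  rwa [op_neg_cancel_left] at h

theorem isClosedEmbedding_gyroLeftTranslation (hH : IsClosed H) (b : G) :
    IsClosedEmbedding (fun h : H => b + (h : G)) :=
  (gyroLeftTranslation b).isClosedEmbedding.comp hH.isClosedEmbedding_subtypeVal

theorem IsLSubgyrogroup.isOpenMap_gyroCosetProj (hL : IsLSubgyrogroup H) :
    IsOpenMap (gyroCosetProj H) := by
  intro U hU
  rw [isOpen_coinduced]
  have : gyroCosetProj H ⁻¹' (gyroCosetProj H '' U) = ⋃ k ∈ H, (fun z => z + k) ⁻¹' U := by
    ext z
    simp only [mem_preimage, mem_image, mem_iUnion, exists_prop]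
    constructor
    · rintro ⟨u, hu, huz⟩
      refine ⟨-z + u, hL.gyroCosetProj_eq_iff.1 huz.symm, ?_⟩
      rwa [op_neg_cancel_left]
    · rintro ⟨k, hk, hzk⟩
      refine ⟨z + k, hzk, Eq.symm ?_⟩
      rw [hL.gyroCosetProj_eq_iff, neg_op_cancel_left]
      exact hk
  rw [this]
  exact isOpen_biUnion fun k _ => hU.preimage (continuous_id.add continuous_const)

/-- An open quotient is Hausdorff once its kernel relation is closed; here that relation is the
preimage of `H` under `(a, b) ↦ -a + b`. -/
theorem IsLSubgyrogroup.t2Space_gyroCosetSpace (hL : IsLSubgyrogroup H) (hH : IsClosed H) :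
    T2Space (GyroCosetSpace H) := by
  have hsurj : Function.Surjective (gyroCosetProj H) := fun ⟨_, a, ha⟩ => ⟨a, Subtype.ext ha⟩
  refine (t2Space_iff_of_isOpenQuotientMap
    ⟨hsurj, continuous_gyroCosetProj, hL.isOpenMap_gyroCosetProj⟩).2 ?_
  simp only [hL.gyroCosetProj_eq_iff]
  exact hH.preimage ((continuous_neg.comp continuous_fst).add continuous_snd)

/-- A point `b` of a fibre of the coset projection that is first-countable along `K` is cut out
of that fibre by the closures of countably many neighbourhoods. -/
theorem exists_antitone_nhds_inter_fibre_subset [T1Space G] (hL : IsLSubgyrogroup H)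
    {K : Set G} {b : G} (hb : b ∈ K)
    (hF : FirstCountableTopology ((fun h : H => b + (h : G)) ⁻¹' K)) :
    ∃ U : ℕ → Set G, Antitone U ∧ (∀ n, U n ∈ 𝓝 b) ∧
      ∀ x ∈ K, gyroCosetProj H x = gyroCosetProj H b → (∀ n, x ∈ closure (U n)) → x = b := by
  set L : Set H := (fun h : H => b + (h : G)) ⁻¹' K
  have h0 : (⟨0, hL.zero_mem⟩ : H) ∈ L := by
    change b + 0 ∈ K
    rwa [op_zero]
  let z : L := ⟨⟨0, hL.zero_mem⟩, h0⟩
  let j : L → G := fun l => b + ((l : H) : G)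
  have hj : IsInducing j :=
    (gyroLeftTranslation b).isInducing.comp (IsInducing.subtypeVal.comp IsInducing.subtypeVal)
  have hjz : j z = b := op_zero b
  obtain ⟨B, hB⟩ := (𝓝 z).exists_antitone_basis
  have hV : ∀ n, ∃ W ∈ 𝓝 b, j ⁻¹' closure W ⊆ B n := fun n => by
    have hn := hB.mem n
    rw [hj.nhds_eq_comap, hjz] at hn
    obtain ⟨V, hV, hVB⟩ := hn
    obtain ⟨W, hW, hWV⟩ := TopologicalGyrogroup.exists_mem_nhds_closure_subset hV
    exact ⟨W, hW, (preimage_mono hWV).trans hVB⟩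
  choose W hW hWB using hV
  -- Finite intersections make the family decreasing.
  refine ⟨fun n => ⋂ k ∈ Iic n, W k, ?_, fun n => (biInter_mem (finite_Iic n)).2 fun k _ => hW k, ?_⟩
  · exact fun m n hmn => biInter_subset_biInter_left (Iic_subset_Iic.2 hmn)
  · intro x hx hxb hxU
    have hxH : -b + x ∈ H := hL.gyroCosetProj_eq_iff.1 hxb.symm
    have hxL : (⟨-b + x, hxH⟩ : H) ∈ L := by
      change b + (-b + x) ∈ K
      rwa [op_neg_cancel_left]
    let l : L := ⟨⟨-b + x, hxH⟩, hxL⟩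
    have hjl : j l = x := op_neg_cancel_left b x
    have hl : ∀ n, l ∈ B n := fun n => hWB n <| by
      rw [mem_preimage, hjl]
      exact closure_mono (biInter_subset_of_mem (mem_Iic.2 le_rfl)) (hxU n)
    -- The `B n` form a basis at `z` and points of `G` are closed, so `z` is the only point in all
    -- `B n`.
    have hzl : l = z := by
      by_contra hne
      obtain ⟨n, -, hn⟩ := hB.1.mem_iff.1 (hj.nhds_eq_comap z ▸
        preimage_mem_comap (show ({x}ᶜ : Set G) ∈ 𝓝 (j z) from
          isOpen_compl_singleton.mem_nhds fun h => hne <| by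
            have h' : (0 : G) = -b + x := by
              rw [← show j z = x from h, hjz, neg_op]
            exact Subtype.ext (Subtype.ext h'.symm)))
      exact hn (hl n) hjl
    rw [← hjl, hzl, hjz]

end Topology

section Lifting

variable {X Y : Type*} [TopologicalSpace X] [TopologicalSpace Y]

/-- Otherwise a subsequence avoiding a neighbourhood of `b` would have a cluster point in `K`,
necessarily `b`. -/
theorem IsCountablyCompact.tendsto_of_unique_mapClusterPt {K : Set X} (hK : IsCountablyCompact K)
    {u : ℕ → X} (hu : ∀ n, u n ∈ K) {b : X}
    (h : ∀ x ∈ K, MapClusterPt x atTop u → x = b) : Tendsto u atTop (𝓝 b) := by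
  by_contra hnot
  obtain ⟨W, hW, hfreq⟩ := not_tendsto_iff_exists_frequently_notMem.1 hnot
  obtain ⟨φ, hφ, hφW⟩ := extraction_of_frequently_atTop hfreq
  obtain ⟨x, hxK, hx⟩ := hK.seq_clusterPt (u ∘ φ) (Eventually.of_forall fun n => hu (φ n))
  obtain rfl := h x hxK (hx.of_comp hφ.tendsto_atTop)
  obtain ⟨n, hn⟩ := (mapClusterPt_iff_frequently.1 hx W hW).exists
  exact hφW n hn

theorem tendsto_of_tendsto_image_of_mem_nhds [T2Space Y] {f : X → Y} (hf : Continuous f)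
    {K : Set X} (hK : IsCountablyCompact K) {b : X} {U : ℕ → Set X} (hU : Antitone U)
    (hUb : ∀ x ∈ K, f x = f b → (∀ n, x ∈ closure (U n)) → x = b)
    {u : ℕ → X} (huK : ∀ n, u n ∈ K) (huU : ∀ n, u n ∈ U n)
    (hfu : Tendsto (f ∘ u) atTop (𝓝 (f b))) : Tendsto u atTop (𝓝 b) := by
  refine hK.tendsto_of_unique_mapClusterPt huK fun x hxK hx => hUb x hxK ?_ fun n => ?_
  · have hfx : MapClusterPt (f x) atTop (f ∘ u) := hx.continuousAt_comp hf.continuousAt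
    exact eq_of_nhds_neBot (hfx.clusterPt.mono hfu)
  · refine mem_closure_iff_clusterPt.2 (hx.clusterPt.mono ?_)
    exact tendsto_principal.2 ((eventually_ge_atTop n).mono fun m hm => hU hm (huU m))

/-- Selections along the images `f '' (A n ∩ U n)` lift to selections along `A n`. -/
theorem exists_seq_tendsto_of_exists_seq_tendsto_image [T2Space Y] {f : X → Y} (hf : Continuous f)
    {K : Set X} (hK : IsCountablyCompact K) (b : K) {U : ℕ → Set X} (hU : Antitone U)
    (hUnhds : ∀ n, U n ∈ 𝓝 (b : X))
    (hUb : ∀ x ∈ K, f x = f b → (∀ n, x ∈ closure (U n)) → x = b)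
    {A : ℕ → Set K} (hA : ∀ n, b ∈ closure (A n))
    (hsel : (∀ n, K.imageFactorization f b ∈
        closure (K.imageFactorization f '' (A n ∩ Subtype.val ⁻¹' U n))) →
      ∃ v : ℕ → f '' K, (∀ n, v n ∈ K.imageFactorization f '' (A n ∩ Subtype.val ⁻¹' U n)) ∧
        Tendsto v atTop (𝓝 (K.imageFactorization f b))) :
    ∃ u : ℕ → K, (∀ n, u n ∈ A n) ∧ Tendsto u atTop (𝓝 b) := by
  have hp : Continuous (K.imageFactorization f) :=
    (hf.comp continuous_subtype_val).subtype_mk _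
  obtain ⟨v, hv, hvt⟩ := hsel fun n => by
    refine image_closure_subset_closure_image hp (mem_image_of_mem _ ?_)
    rw [mem_closure_iff_frequently]
    exact (mem_closure_iff_frequently.1 (hA n)).and_eventually
      (continuous_subtype_val.continuousAt (hUnhds n))
  choose u hu huv using hv
  refine ⟨u, fun n => (hu n).1, tendsto_subtype_rng.2 ?_⟩
  refine tendsto_of_tendsto_image_of_mem_nhds hf hK hU hUb (fun n => (u n).2)
    (fun n => (hu n).2) ?_
  have h := (continuous_subtype_val.tendsto _).comp hvt
  refine h.congr fun n => ?_
  rw [Function.comp_apply, ← huv n]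
  rfl

theorem StronglyFrechetUrysohn.of_image [T2Space Y] {f : X → Y} (hf : Continuous f)
    {K : Set X} (hK : IsCountablyCompact K)
    (hU : ∀ b ∈ K, ∃ U : ℕ → Set X, Antitone U ∧ (∀ n, U n ∈ 𝓝 b) ∧
      ∀ x ∈ K, f x = f b → (∀ n, x ∈ closure (U n)) → x = b)
    (hfK : StronglyFrechetUrysohn (f '' K)) : StronglyFrechetUrysohn K := by
  intro b A hA hbA
  obtain ⟨U, hUa, hUn, hUb⟩ := hU b b.2
  -- Since `U` decreases along with `A`, so do the images of `A n ∩ U n`.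
  exact exists_seq_tendsto_of_exists_seq_tendsto_image hf hK b hUa hUn hUb hbA <|
    hfK _ _ fun m n hmn => image_mono (inter_subset_inter (hA hmn) (preimage_mono (hUa hmn)))

theorem StrictlyFrechetUrysohn.of_image [T2Space Y] {f : X → Y} (hf : Continuous f)
    {K : Set X} (hK : IsCountablyCompact K)
    (hU : ∀ b ∈ K, ∃ U : ℕ → Set X, Antitone U ∧ (∀ n, U n ∈ 𝓝 b) ∧
      ∀ x ∈ K, f x = f b → (∀ n, x ∈ closure (U n)) → x = b)
    (hfK : StrictlyFrechetUrysohn (f '' K)) : StrictlyFrechetUrysohn K := by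
  intro b A hbA
  obtain ⟨U, hUa, hUn, hUb⟩ := hU b b.2
  exact exists_seq_tendsto_of_exists_seq_tendsto_image hf hK b hUa hUn hUb hbA (hfK _ _)

theorem Topology.IsClosedEmbedding.isCountablyCompact_preimage {f : X → Y}
    (hf : IsClosedEmbedding f) {K : Set Y} (hK : IsCountablyCompact K) :
    IsCountablyCompact (f ⁻¹' K) := by
  refine .of_seq_clusterPt fun x hx => ?_
  obtain ⟨a, haK, ha⟩ := hK.seq_clusterPt (f ∘ x) hx
  obtain ⟨c, rfl⟩ : a ∈ range f := isClosed_iff_clusterPt.1 hf.isClosed_range a <|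
    ha.clusterPt.mono (tendsto_principal.2 (Eventually.of_forall fun n => mem_range_self (x n)))
  exact ⟨c, haK, hf.isInducing.mapClusterPt_iff.1 ha⟩

theorem Topology.IsClosedEmbedding.isSeqCompact_preimage {f : X → Y}
    (hf : IsClosedEmbedding f) {K : Set Y} (hK : IsSeqCompact K) :
    IsSeqCompact (f ⁻¹' K) := by
  intro x hx
  obtain ⟨a, haK, φ, hφ, ha⟩ := hK (x := f ∘ x) hx
  obtain ⟨c, rfl⟩ : a ∈ range f := hf.isClosed_range.mem_of_tendsto ha
    (Eventually.of_forall fun n => mem_range_self (x (φ n)))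
  exact ⟨c, haK, φ, hφ, hf.isInducing.tendsto_nhds_iff.2 ha⟩

end Lifting

/-- The lifting theorem for any class of countably compact sets that is stable under the coset
projection and under preimages by the closed embeddings `h ↦ b + h`. -/
theorem frechetUrysohn_lift {G : Type*} [TopologicalSpace G] [T2Space G] [Gyrogroup G]
    [TopologicalGyrogroup G] {H : Set G} (hL : IsLSubgyrogroup H) (hH : IsClosed H)
    {PH : Set H → Prop} {PQ : Set (GyroCosetSpace H) → Prop} {PG : Set G → Prop}
    (hcc : ∀ K, PG K → IsCountablyCompact K)
    (himage : ∀ K, PG K → PQ (gyroCosetProj H '' K))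
    (hpre : ∀ K, PG K → ∀ b : G, PH ((fun h : H => b + (h : G)) ⁻¹' K))
    (hfirst : ∀ K : Set H, PH K → FirstCountableTopology K) :
    ((∀ K : Set (GyroCosetSpace H), PQ K → StronglyFrechetUrysohn K) →
      ∀ K : Set G, PG K → StronglyFrechetUrysohn K) ∧
    ((∀ K : Set (GyroCosetSpace H), PQ K → StrictlyFrechetUrysohn K) →
      ∀ K : Set G, PG K → StrictlyFrechetUrysohn K) := by
  have := hL.t2Space_gyroCosetSpace hH
  have hU := fun K (hK : PG K) b hb =>
    exists_antitone_nhds_inter_fibre_subset hL (K := K) (b := b) hb (hfirst _ (hpre K hK b))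
  exact ⟨fun h K hK => .of_image continuous_gyroCosetProj (hcc K hK) (hU K hK) (h _ (himage K hK)),
    fun h K hK => .of_image continuous_gyroCosetProj (hcc K hK) (hU K hK) (h _ (himage K hK))⟩

theorem theorem4p11 {G : Type*} [TopologicalSpace G] [T2Space G] [Gyrogroup G]
    [TopologicalGyrogroup G] (H : Set G) (hL : IsLSubgyrogroup H) (hH : IsClosed H) :
    -- compact subsets
    ((∀ K : Set H, IsCompact K → FirstCountableTopology K) →
      ((∀ K : Set (GyroCosetSpace H), IsCompact K → StronglyFrechetUrysohn K) →
        ∀ K : Set G, IsCompact K → StronglyFrechetUrysohn K) ∧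
      ((∀ K : Set (GyroCosetSpace H), IsCompact K → StrictlyFrechetUrysohn K) →
        ∀ K : Set G, IsCompact K → StrictlyFrechetUrysohn K)) ∧
    -- countably compact subsets
    ((∀ K : Set H, IsCountablyCompact K → FirstCountableTopology K) →
      ((∀ K : Set (GyroCosetSpace H), IsCountablyCompact K → StronglyFrechetUrysohn K) →
        ∀ K : Set G, IsCountablyCompact K → StronglyFrechetUrysohn K) ∧
      ((∀ K : Set (GyroCosetSpace H), IsCountablyCompact K → StrictlyFrechetUrysohn K) →
        ∀ K : Set G, IsCountablyCompact K → StrictlyFrechetUrysohn K)) ∧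
    -- sequentially compact subsets
    ((∀ K : Set H, IsSeqCompact K → FirstCountableTopology K) →
      ((∀ K : Set (GyroCosetSpace H), IsSeqCompact K → StronglyFrechetUrysohn K) →
        ∀ K : Set G, IsSeqCompact K → StronglyFrechetUrysohn K) ∧
      ((∀ K : Set (GyroCosetSpace H), IsSeqCompact K → StrictlyFrechetUrysohn K) →
        ∀ K : Set G, IsSeqCompact K → StrictlyFrechetUrysohn K)) := by
  have he := isClosedEmbedding_gyroLeftTranslation hH
  have hπ : Continuous (gyroCosetProj H) := continuous_gyroCosetProj
  exact ⟨frechetUrysohn_lift hL hH (fun _ => IsCompact.isCountablyCompact)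
      (fun _ hK => hK.image hπ) (fun _ hK b => (he b).isCompact_preimage hK),
    frechetUrysohn_lift hL hH (fun _ => id)
      (fun _ hK => hK.image hπ) (fun _ hK b => (he b).isCountablyCompact_preimage hK),
    frechetUrysohn_lift hL hH (fun _ => IsSeqCompact.isCountablyCompact)
      (fun _ hK => hK.image hπ.seqContinuous) (fun _ hK b => (he b).isSeqCompact_preimage hK)⟩
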